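/- Let $n\ge 1$, $[n]=\{1,\dots,n\}$, let $\mathfrak S_n$ be the symmetric group on $[n]$ and $\mathfrak D_n\subseteq\mathfrak S_n$ the set of derangements (permutations without fixed points). For $g:[n]\to[n]$ put $\mathrm{EXCv}(g)=\{g(j): g(j)>j\}$ and $\mathrm{RLMv}(g)=\{g(i): g(i)<g(j)\text{ for all } j>i\}$. A subexcedant function on $[n]$ is a map $f:[n]\to[n]$ with $f(i)\le i$ for all $i$; let $\mathrm{IM}(f)$ be its image and $\mathrm{aexc}(f)=|\{i: f(i)<i\}|$. The map $f\mapsto (n\ f(n))\cdots(2\ f(2))(1\ f(1))$ (composed from right to left, where $(i\ i)$ is the identity) is a bijection from subexcedant functions on $[n]$ to $\mathfrak S_n$; write $f_\sigma$ for the preimage of $\sigma$. Let $\mathcal{DF}_n=\{f_\sigma:\sigma\in\mathfrak D_n\}$. Call $f$ matchless if, as a word, $f=1\,1\,2\,3\cdots (k{-}1)\,k\,k\cdots k$ for some $1\le k\le n-1$, that is, $f(1)=1$ and $f(p)=\min(p-1,k)$ for $2\le p\le n$. Call $\sigma\in\mathfrak D_n$ matchless if $f_\sigma$ is. Define $\Psi$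 on $\mathcal{DF}_n$ as follows. If $f$ is matchless, $\Psi(f)=f$. Otherwise write $\mathrm{IM}(f)=\{m_1<\dots<m_\ell\}$. For $2\le i\le\ell$ let $\mathrm{fix}_i(f)$, respectively $\mathrm{unfix}_i(f)$, be obtained from $f$ by changing the value at $m_i$ to $m_i$, respectively to $m_{i-1}$. Say that $(E_i)$ holds if $f(m_i)<m_i<m_\ell$, $f^{-1}(1)=\{1,2\}$ and $\{m_i+1\}\subsetneq f^{-1}(m_i)$. Take the smallest $i\in\{2,\dots,\ell\}$ for which one of the following (mutually exclusive) cases applies, and define $\Psi(f)$ accordingly: 1. if $f(m_i)=m_i$, then $\Psi(f)=\mathrm{unfix}_i(f)$; 2. if $f(m_i)<m_i$ and $|f^{-1}(1)|\ge 3$, then $\Psi(f)=\mathrm{fix}_i(f)$; 3. if $(E_i)$ holds and $f(m_{i+1})=m_{i+1}$, then $\Psi(f)=\mathrm{unfix}_{i+1}(f)$; 4. if $(E_i)$ holds and $f(m_{i+1})<m_{i+1}$, then $\Psi(f)=\mathrm{fix}_{i+1}(f)$. (If no case applied, one would put $\Psi(f)=f$; by the first part of the theorem this does not occur for non-matchless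 $f\in\mathcal{DF}_n$.) For $\sigma\in\mathfrak D_n$ let $\hat\Psi(\sigma)$ be the permutation $\tau$ with $f_\tau=\Psi(f_\sigma)$. **Theorem.** The map $\Psi$ is an involution $\mathcal{DF}_n\to\mathcal{DF}_n$ whose fixed elements are exactly the matchless subexcedant functions on $[n]$. For all $f\in\mathcal{DF}_n$ one has $\mathrm{IM}(\Psi(f))=\mathrm{IM}(f)$ and $\mathrm{RLMv}(\Psi(f))=\mathrm{RLMv}(f)$, and if $f$ is not matchless, then $\mathrm{aexc}(\Psi(f))=\mathrm{aexc}(f)\pm1$. The map $\hat\Psi$ is an involution $\mathfrak D_n\to\mathfrak D_n$ whose fixed elements are exactly the matchless derangements, and there are exactly $n-1$ of these. For all $\sigma\in\mathfrak D_n$ one has $\mathrm{EXCv}(\hat\Psi(\sigma))=\mathrm{EXCv}(\sigma)$ and $\mathrm{RLMv}(\hat\Psi(\sigma))=\mathrm{RLMv}(\sigma)$, and if $\sigma$ is not matchless, then $\mathrm{sgn}(\hat\Psi(\sigma))=-\mathrm{sgn}(\sigma)$. -/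

import Mathlib

/-!
Throughout, the set `[n] = {1, ..., n}` is modelled by `Fin n`: the element `i : Fin n` stands for
the number `(i : ℕ) + 1`. Permutations of `[n]` are `Equiv.Perm (Fin n)`, and the set of derangements
is Mathlib's `derangements (Fin n)`.
-/

namespace Subexcedant

/-! ### Statistics of functions `g : [n] → [n]` -/

/-- Excedance indices: `{ j : g(j) > j }`. -/
def EXCi {n : ℕ} (g : Fin n → Fin n) : Finset (Fin n) :=
  Finset.univ.filter fun j => j < g j

/-- Excedance values. -/
def EXCv {n : ℕ} (g : Fin n → Fin n) : Finset (Fin n) :=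
  (EXCi g).image g

/-- Right-to-left minima indices: `{ i : g(i) < g(j) for all j > i }`. -/
def RLMi {n : ℕ} (g : Fin n → Fin n) : Finset (Fin n) :=
  Finset.univ.filter fun i => ∀ j, i < j → g i < g j

/-- Right-to-left minima values. -/
def RLMv {n : ℕ} (g : Fin n → Fin n) : Finset (Fin n) :=
  (RLMi g).image g

/-! ### Subexcedant functions -/

/-- Subexcedant functions on `[n]`: functions `f : [n] → [n]` with `f(i) ≤ i` for all `i`. -/
abbrev SEF (n : ℕ) : Type := {f : Fin n → Fin n // ∀ i, f i ≤ i}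

/-- The image of a subexcedant function. -/
def supp {n : ℕ} (f : SEF n) : Finset (Fin n) := Finset.univ.image f.1

/-- The number of strict anti-excedances, i.e. of the `i` with `f(i) < i`. -/
def aexc {n : ℕ} (f : SEF n) : ℕ := (Finset.univ.filter fun i => f.1 i < i).card

/-- The permutation `(n f(n)) ⋯ (2 f(2)) (1 f(1))`, a product of transpositions (or identities)
composed from right to left. -/
def sefToPerm {n : ℕ} (f : SEF n) : Equiv.Perm (Fin n) :=
  ((List.finRange n).reverse.map fun i => Equiv.swap i (f.1 i)).prod

theorem swapProd_fix {n : ℕ} (f : SEF n) (a : Fin n) (l : List (Fin n)) (h : ∀ b ∈ l, b < a) :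
    (l.map fun i => Equiv.swap i (f.1 i)).prod a = a := by
  induction l with
  | nil => simp
  | cons b l ih =>
    have hb : b < a := h b (by simp)
    have hl := ih fun c hc => h c (by simp [hc])
    rw [List.map_cons, List.prod_cons, Equiv.Perm.mul_apply, hl]
    exact Equiv.swap_apply_of_ne_of_ne hb.ne' ((f.2 b).trans_lt hb).ne'

theorem swapProd_inj {n : ℕ} (f g : SEF n) (l : List (Fin n)) (hl : l.Pairwise (· > ·))
    (h : (l.map fun i => Equiv.swap i (f.1 i)).prod = (l.map fun i => Equiv.swap i (g.1 i)).prod) :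
    ∀ i ∈ l, f.1 i = g.1 i := by
  induction l with
  | nil => simp
  | cons a l ih =>
    rw [List.pairwise_cons] at hl
    rw [List.map_cons, List.prod_cons, List.map_cons, List.prod_cons] at h
    have ha : f.1 a = g.1 a := by
      have h1 := congrArg (fun σ : Equiv.Perm (Fin n) => σ a) h
      simpa [Equiv.Perm.mul_apply, swapProd_fix f a l hl.1, swapProd_fix g a l hl.1] using h1
    rw [ha] at h
    intro i hi
    rcases List.mem_cons.1 hi with rfl | hi
    · exact ha
    · exact ih hl.2 (mul_left_cancel h) i hi

theorem sefToPerm_injective (n : ℕ) : Function.Injective (sefToPerm (n := n)) := by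
  intro f g h
  have hp : (List.finRange n).reverse.Pairwise (· > ·) := by
    rw [List.pairwise_reverse]
    exact List.pairwise_lt_finRange n
  exact Subtype.ext (funext fun i => swapProd_inj f g _ hp h i (by simp))

theorem card_SEF (n : ℕ) : Fintype.card (SEF n) = n.factorial := by
  have h : Fintype.card (SEF n) = (Fintype.piFinset fun i : Fin n => Finset.Iic i).card := by
    rw [Fintype.card_subtype]
    congr 1
    ext f
    simp [Fintype.mem_piFinset]
  rw [h, Fintype.card_piFinset]
  simp only [Fin.card_Iic]
  rw [Fin.prod_univ_eq_prod_range (fun i => i + 1) n, Finset.prod_range_add_one_eq_factorial]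

theorem sefToPerm_bijective (n : ℕ) : Function.Bijective (sefToPerm (n := n)) := by
  rw [Fintype.bijective_iff_injective_and_card]
  refine ⟨sefToPerm_injective n, ?_⟩
  rw [card_SEF, Fintype.card_perm, Fintype.card_fin]

/-- The bijection `sefToPerm` between subexcedant functions and permutations. -/
noncomputable def sefEquivPerm (n : ℕ) : SEF n ≃ Equiv.Perm (Fin n) :=
  Equiv.ofBijective sefToPerm (sefToPerm_bijective n)

/-- The subexcedant function `f_σ` of a permutation `σ`: the inverse of `sefToPerm`. -/
noncomputable def permToSef {n : ℕ} (σ : Equiv.Perm (Fin n)) : SEF n := (sefEquivPerm n).symm σ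

/-- `f` is matchless if it is the word `1 1 2 3 ⋯ (k-1) k k ⋯ k` for some `1 ≤ k ≤ n - 1`, i.e.
`f(1) = 1` and `f(p) = min (p - 1) k` for `2 ≤ p ≤ n`. Here position `p` is `j` with
`p = (j : ℕ) + 1`. -/
def IsMatchless {n : ℕ} (f : SEF n) : Prop :=
  ∃ k ∈ Finset.Icc 1 (n - 1), ∀ j : Fin n,
    (f.1 j : ℕ) + 1 = if (j : ℕ) = 0 then 1 else min (j : ℕ) k

instance {n : ℕ} (f : SEF n) : Decidable (IsMatchless f) := by
  unfold IsMatchless; infer_instance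

/-- The subexcedant functions of derangements. -/
def DF (n : ℕ) : Set (SEF n) := permToSef '' derangements (Fin n)

/-- Derangements whose subexcedant function is matchless. -/
def matchlessDerangements (n : ℕ) : Set (Equiv.Perm (Fin n)) :=
  {σ | σ ∈ derangements (Fin n) ∧ IsMatchless (permToSef σ)}

/-! ### The map `Ψ`

Write `supp f = {m_1 < m_2 < ⋯ < m_ℓ}`. Instead of the index `i`, the definitions below
use the element `m = m_i` of `supp f` itself. Since `m_1 = 1`, the range `i ≥ 2` is `m ≠ 1`, that is
`(m : ℕ) ≠ 0`, and choosing the smallest index `i` is choosing the smallest element `m`. -/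

/-- For `m = m_i`, the preceding element `m_{i-1}` of the image (`m` itself if there is none). -/
def prevVal {n : ℕ} (f : SEF n) (m : Fin n) : Fin n :=
  if h : ((supp f).filter fun x => x < m).Nonempty then ((supp f).filter fun x => x < m).max' h
  else m

/-- For `m = m_i`, the following element `m_{i+1}` of the image (`m` itself if there is none). -/
def nextVal {n : ℕ} (f : SEF n) (m : Fin n) : Fin n :=
  if h : ((supp f).filter fun x => m < x).Nonempty then ((supp f).filter fun x => m < x).min' h
  else m

theorem prevVal_le {n : ℕ} (f : SEF n) (m : Fin n) : prevVal f m ≤ m := by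
  unfold prevVal
  split_ifs with h
  · exact (Finset.mem_filter.1 (Finset.max'_mem _ h)).2.le
  · exact le_rfl

theorem update_le {n : ℕ} (f : SEF n) {m v : Fin n} (hv : v ≤ m) (i : Fin n) :
    Function.update f.1 m v i ≤ i := by
  rcases eq_or_ne i m with rfl | hi
  · simpa using hv
  · simpa [Function.update_of_ne hi] using f.2 i

/-- `fix_i`: redefine `f(m_i)` to be `m_i`. -/
def fixMap {n : ℕ} (f : SEF n) (m : Fin n) : SEF n :=
  ⟨Function.update f.1 m m, update_le f le_rfl⟩

/-- `unfix_i`: redefine `f(m_i)` to be `m_{i-1}`. -/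
def unfixMap {n : ℕ} (f : SEF n) (m : Fin n) : SEF n :=
  ⟨Function.update f.1 m (prevVal f m), update_le f (prevVal_le f m)⟩

/-- The preimage `f⁻¹(m)`. -/
def fiber {n : ℕ} (f : SEF n) (m : Fin n) : Finset (Fin n) :=
  Finset.univ.filter fun j => f.1 j = m

/-- The preimage `f⁻¹(1)`. -/
def fiberOne {n : ℕ} (f : SEF n) : Finset (Fin n) :=
  Finset.univ.filter fun j => (f.1 j : ℕ) = 0

/-- Condition (E_i), with `m = m_i`: `f(m_i) < m_i < m_ℓ`, `f⁻¹(1) = {1, 2}` and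
`{m_i + 1} ⊊ f⁻¹(m_i)`. -/
def CondE {n : ℕ} (f : SEF n) (m : Fin n) : Prop :=
  f.1 m < m ∧ (∃ x ∈ supp f, m < x) ∧
  fiberOne f = (Finset.univ.filter fun j : Fin n => (j : ℕ) < 2) ∧
  ∃ j : Fin n, (j : ℕ) = (m : ℕ) + 1 ∧ {j} ⊂ fiber f m

instance {n : ℕ} (f : SEF n) (m : Fin n) : Decidable (CondE f m) := by
  unfold CondE; infer_instance

/-- First case, for `m = m_i`. -/
abbrev CaseOne {n : ℕ} (f : SEF n) (m : Fin n) : Prop := f.1 m = m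

/-- Second case, for `m = m_i`. -/
abbrev CaseTwo {n : ℕ} (f : SEF n) (m : Fin n) : Prop := f.1 m < m ∧ 3 ≤ (fiberOne f).card

/-- Third case, for `m = m_i`. -/
abbrev CaseThree {n : ℕ} (f : SEF n) (m : Fin n) : Prop :=
  CondE f m ∧ f.1 (nextVal f m) = nextVal f m

/-- Fourth case, for `m = m_i`. -/
abbrev CaseFour {n : ℕ} (f : SEF n) (m : Fin n) : Prop :=
  CondE f m ∧ f.1 (nextVal f m) < nextVal f m

/-- The elements `m = m_i`, `i ≥ 2`, of the image to which one of the four cases applies. -/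
def active {n : ℕ} (f : SEF n) : Finset (Fin n) :=
  (supp f).filter fun m =>
    (m : ℕ) ≠ 0 ∧ (CaseOne f m ∨ CaseTwo f m ∨ CaseThree f m ∨ CaseFour f m)

/-- The map `Ψ`. It fixes matchless functions. Otherwise take the smallest `m = m_i`, `i ≥ 2`, to
which one of the four (mutually exclusive) cases applies, and modify `f` accordingly. It is meant for
`f ∈ DF n`; if `f` is not matchless and no case applies, the value is `f`. -/
def Psi {n : ℕ} (f : SEF n) : SEF n :=
  if IsMatchless f then f
  else if h : (active f).Nonempty then
    let m := (active f).min' h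
    if CaseOne f m then unfixMap f m
    else if CaseTwo f m then fixMap f m
    else if CaseThree f m then unfixMap f (nextVal f m)
    else fixMap f (nextVal f m)
  else f

/-- The map `Ψ̂ = sefToPerm ∘ Ψ ∘ sefToPerm⁻¹` on permutations; it is meant for derangements. -/
noncomputable def PsiHat {n : ℕ} (σ : Equiv.Perm (Fin n)) : Equiv.Perm (Fin n) :=
  sefToPerm (Psi (permToSef σ))

end Subexcedant

open Subexcedant

namespace Subexcedant

/-! ### The bijection between subexcedant functions and permutations -/

/-! `Ψ` changes at most one value of `f`: at an element `w` of the image it switches `f w` between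
`w` and the preceding element `p` of the image. The orbits can therefore be described without the
four cases. `Toggle f w p` collects conditions under which `f`, with `f w = p`, and `fixMap f w`
form such a pair. Up to position `p` the function starts like a matchless one, and beyond `p` its
values are at least `p`, so no case applies below `p` and `Ψ` must act at `w` (`Psi_eq_fixMap`,
`Psi_fixMap`). Further preimages of `p` and `w` make the image, `RLMv` and membership in `DF n`
insensitive to the switch, while `aexc` changes by one. Conversely (`exists_toggle`), in a
non-matchless element of `DF n` the first departure from the matchless pattern yields such a pair.

The transfer to permutations rests on one observation: `sefToPerm f` sends the last position with
value `v` to `v`, and sends every other position to a larger number. Hence `EXCv` is the complement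
of the image, `RLMv` agrees on both sides, and derangements are recognised by the fixed points of
`f`. The sign is `(-1) ^ aexc f`. -/

theorem swapProd_eq_self {n : ℕ} (f : SEF n) (a : Fin n) (l : List (Fin n))
    (h : ∀ b ∈ l, a ≠ b ∧ a ≠ f.1 b) :
    (l.map fun i => Equiv.swap i (f.1 i)).prod a = a := by
  induction l with
  | nil => simp
  | cons b l ih =>
    rw [List.map_cons, List.prod_cons, Equiv.Perm.mul_apply, ih fun c hc => h c (by simp [hc])]
    exact Equiv.swap_apply_of_ne_of_ne (h b (by simp)).1 (h b (by simp)).2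

/-- The transpositions act in increasing order of `b`, so the running value, which is `a` or an
earlier position, is never `b` itself. It moves only when it equals `f b`, and then it becomes `b`.
-/
theorem swapProd_eq_or_mem {n : ℕ} (f : SEF n) (a : Fin n) (l : List (Fin n))
    (hl : l.Pairwise (· > ·)) (h : ∀ b ∈ l, a < b) :
    (l.map fun i => Equiv.swap i (f.1 i)).prod a = a ∨
      (l.map fun i => Equiv.swap i (f.1 i)).prod a ∈ l := by
  induction l with
  | nil => simp
  | cons b l ih =>
    rw [List.pairwise_cons] at hl
    rw [List.map_cons, List.prod_cons, Equiv.Perm.mul_apply]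
    have ih := ih hl.2 fun c hc => h c (by simp [hc])
    set x := (l.map fun i => Equiv.swap i (f.1 i)).prod a
    have hx : x ≠ b := by
      rcases ih with hx | hx
      · rw [hx]; exact (h b (by simp)).ne
      · exact (hl.1 x hx).ne
    by_cases hxf : x = f.1 b
    · rw [hxf, Equiv.swap_apply_right]; simp
    · rw [Equiv.swap_apply_of_ne_of_ne hx hxf]
      rcases ih with hx | hx
      · exact Or.inl hx
      · exact Or.inr (by simp [hx])

/-- Applying `sefToPerm f` to `k` sends `k` to `f k` and then applies the transpositions attached to
the larger positions. -/
theorem exists_sefToPerm_apply {n : ℕ} (f : SEF n) (k : Fin n) :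
    ∃ l : List (Fin n), l.Pairwise (· > ·) ∧ (∀ b ∈ l, k < b) ∧
      sefToPerm f k = (l.map fun i => Equiv.swap i (f.1 i)).prod (f.1 k) := by
  have hp : (List.finRange n).reverse.Pairwise (· > ·) := by
    rw [List.pairwise_reverse]
    exact List.pairwise_lt_finRange n
  obtain ⟨l₁, l₂, hl⟩ := List.append_of_mem (show k ∈ (List.finRange n).reverse by simp)
  rw [hl, List.pairwise_append, List.pairwise_cons] at hp
  refine ⟨l₁, hp.1, fun b hb => hp.2.2 b hb k (by simp), ?_⟩
  rw [sefToPerm, hl, List.map_append, List.prod_append, List.map_cons, List.prod_cons,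
    Equiv.Perm.mul_apply, Equiv.Perm.mul_apply, swapProd_fix f k l₂ hp.2.1.1,
    Equiv.swap_apply_left]

theorem sefToPerm_apply_of_last {n : ℕ} (f : SEF n) (k : Fin n)
    (h : ∀ j, k < j → f.1 j ≠ f.1 k) : sefToPerm f k = f.1 k := by
  obtain ⟨l, -, hl, hk⟩ := exists_sefToPerm_apply f k
  rw [hk]
  exact swapProd_eq_self f _ l fun b hb =>
    ⟨((f.2 k).trans_lt (hl b hb)).ne, (h b (hl b hb)).symm⟩

theorem sefToPerm_apply_eq_or_lt {n : ℕ} (f : SEF n) (k : Fin n) :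
    sefToPerm f k = f.1 k ∨ k < sefToPerm f k := by
  obtain ⟨l, hp, hl, hk⟩ := exists_sefToPerm_apply f k
  rw [hk]
  exact (swapProd_eq_or_mem f _ l hp fun b hb => (f.2 k).trans_lt (hl b hb)).imp id (hl _)

theorem mem_supp {n : ℕ} (f : SEF n) (v : Fin n) : v ∈ supp f ↔ ∃ j, f.1 j = v := by
  simp [supp]

/-- The last position at which `f` takes the value of `j`. -/
theorem exists_last {n : ℕ} (f : SEF n) (j : Fin n) :
    ∃ k, j ≤ k ∧ f.1 k = f.1 j ∧ sefToPerm f k = f.1 j ∧ ∀ i, k < i → f.1 i ≠ f.1 j := by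
  have hne : (fiber f (f.1 j)).Nonempty := ⟨j, by simp [fiber]⟩
  have hk : f.1 ((fiber f (f.1 j)).max' hne) = f.1 j := by
    simpa [fiber] using Finset.max'_mem _ hne
  have hlast : ∀ i, (fiber f (f.1 j)).max' hne < i → f.1 i ≠ f.1 j := fun i hi h =>
    absurd (Finset.le_max' (fiber f (f.1 j)) i (by simp [fiber, h])) (not_le.2 hi)
  refine ⟨_, Finset.le_max' _ j (by simp [fiber]), hk, ?_, hlast⟩
  exact (sefToPerm_apply_of_last f _ fun i hi => by rw [hk]; exact hlast i hi).trans hk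

/-- A value `v` of `f` is attained by the permutation at its last position `k ≥ v`, hence not at an
excedance. A non-value cannot come from `σ i = f i`, so it comes from `σ i > i`. -/
theorem EXCv_sefToPerm {n : ℕ} (f : SEF n) : EXCv (sefToPerm f) = (supp f)ᶜ := by
  ext v
  rw [Finset.mem_compl, mem_supp]
  simp only [EXCv, EXCi, Finset.mem_image, Finset.mem_filter, Finset.mem_univ, true_and]
  constructor
  · rintro ⟨i, hi, rfl⟩ ⟨j, hj⟩
    obtain ⟨k, hjk, -, hσ, -⟩ := exists_last f j
    rw [hj] at hσ
    have hki : k = i := (sefToPerm f).injective hσ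
    subst hki
    have h1 := f.2 j
    rw [hj] at h1
    exact absurd (h1.trans hjk) (not_le.2 hi)
  · intro h
    refine ⟨(sefToPerm f).symm v, ?_, by simp⟩
    rcases sefToPerm_apply_eq_or_lt f ((sefToPerm f).symm v) with h1 | h1
    · exact absurd ⟨_, h1.symm.trans (by simp)⟩ h
    · simpa using h1

theorem mem_RLMv {n : ℕ} (g : Fin n → Fin n) (v : Fin n) :
    v ∈ RLMv g ↔ ∃ i, g i = v ∧ ∀ j, i < j → v < g j := by
  simp only [RLMv, RLMi, Finset.mem_image, Finset.mem_filter, Finset.mem_univ, true_and]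
  constructor
  · rintro ⟨i, h, rfl⟩; exact ⟨i, rfl, h⟩
  · rintro ⟨i, rfl, h⟩; exact ⟨i, h, rfl⟩

theorem RLMv_sefToPerm {n : ℕ} (f : SEF n) : RLMv (sefToPerm f) = RLMv f.1 := by
  ext v
  rw [mem_RLMv, mem_RLMv]
  constructor
  · rintro ⟨i, hi, h⟩
    have hif : f.1 i = v := by
      rcases sefToPerm_apply_eq_or_lt f i with h1 | h1
      · rw [← h1, hi]
      · rw [hi] at h1
        -- If `i < v`, all values up to `v` would have to sit at the fewer positions up to `i`.
        have hmaps : ∀ u ∈ Finset.Iic v, (sefToPerm f).symm u ∈ Finset.Iic i := by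
          intro u hu
          rw [Finset.mem_Iic] at hu ⊢
          by_contra hc
          have := h _ (not_le.1 hc)
          rw [Equiv.apply_symm_apply] at this
          exact absurd hu (not_le.2 this)
        have hc := Finset.card_le_card_of_injOn _ hmaps (sefToPerm f).symm.injective.injOn
        simp only [Fin.card_Iic] at hc
        have : (i : ℕ) < v := h1
        omega
    refine ⟨i, hif, fun j hj => ?_⟩
    by_contra hc
    -- The last position with value `f j` lies beyond `i`, and the permutation takes the value `f j`
    -- there.
    obtain ⟨k, hjk, -, hσ, -⟩ := exists_last f j
    have := h k (hj.trans_le hjk)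
    rw [hσ] at this
    exact hc this
  · rintro ⟨i, hi, h⟩
    refine ⟨i, ?_, fun j hj => ?_⟩
    · rw [sefToPerm_apply_of_last f i fun j hj => by rw [hi]; exact (h j hj).ne', hi]
    · rcases sefToPerm_apply_eq_or_lt f j with h1 | h1
      · rw [h1]; exact h j hj
      · exact (hi ▸ f.2 i : v ≤ i).trans_lt (hj.trans h1)

/-- A fixed point `i` of the permutation is not moved up, so `f i = i`. If the value `i` recurs
later, its last position is sent to `i` instead. -/
theorem sefToPerm_mem_derangements {n : ℕ} (f : SEF n) :
    sefToPerm f ∈ derangements (Fin n) ↔ ∀ i, f.1 i = i → ∃ j, i < j ∧ f.1 j = i := by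
  constructor
  · intro h i hi
    by_contra! hc
    exact h i ((sefToPerm_apply_of_last f i fun j hj => by rw [hi]; exact hc j hj).trans hi)
  · intro h i hi
    rcases sefToPerm_apply_eq_or_lt f i with h1 | h1
    · obtain ⟨j, hij, hj⟩ := h i (h1.symm.trans hi)
      obtain ⟨k, hjk, -, hσ, -⟩ := exists_last f j
      have : k = i := (sefToPerm f).injective (by rw [hσ, hj, hi])
      exact absurd (hij.trans_le hjk) (by rw [this]; exact lt_irrefl _)
    · exact absurd h1 (by rw [hi]; exact lt_irrefl _)

theorem sign_sefToPerm {n : ℕ} (f : SEF n) : Equiv.Perm.sign (sefToPerm f) = (-1) ^ aexc f := by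
  rw [sefToPerm, map_list_prod, List.map_map, List.map_reverse, List.prod_reverse,
    ← List.ofFn_eq_map, List.prod_ofFn]
  have : ∀ i : Fin n, (⇑Equiv.Perm.sign ∘ fun i => Equiv.swap i (f.1 i)) i =
      if f.1 i < i then -1 else 1 := by
    intro i
    rcases (f.2 i).lt_or_eq with h | h
    · simp [h, Equiv.Perm.sign_swap h.ne']
    · simp [h]
  simp only [this]
  rw [Finset.prod_ite, Finset.prod_const, Finset.prod_const_one, mul_one, aexc]

theorem permToSef_sefToPerm {n : ℕ} (f : SEF n) : permToSef (sefToPerm f) = f :=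
  (sefEquivPerm n).symm_apply_apply f

theorem sefToPerm_permToSef {n : ℕ} (σ : Equiv.Perm (Fin n)) : sefToPerm (permToSef σ) = σ :=
  (sefEquivPerm n).apply_symm_apply σ

theorem mem_DF {n : ℕ} (f : SEF n) : f ∈ DF n ↔ sefToPerm f ∈ derangements (Fin n) := by
  constructor
  · rintro ⟨σ, hσ, rfl⟩
    rwa [sefToPerm_permToSef]
  · exact fun h => ⟨_, h, permToSef_sefToPerm f⟩

theorem mem_DF_iff {n : ℕ} (f : SEF n) :
    f ∈ DF n ↔ ∀ i, f.1 i = i → ∃ j, i < j ∧ f.1 j = i := by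
  rw [mem_DF, sefToPerm_mem_derangements]


/-! ### Pairs of functions exchanged by `Ψ` -/

/-- `f` and `fixMap f w` are exchanged by `Ψ`; here `w` and `p` are consecutive elements of the image
of `f` and `f w = p`. -/
structure Toggle {n : ℕ} (f : SEF n) (w p : Fin n) : Prop where
  lt : p < w
  val : f.1 w = p
  gap : ∀ j, f.1 j ≤ p ∨ w ≤ f.1 j
  mem : ∃ j, f.1 j = w
  other : ∃ i, p < i ∧ i ≠ w ∧ f.1 i = p
  -- Truncated subtraction: the word starts `0, 0, 1, 2, …`, position `0` included.
  low : ∀ j, j ≤ p → (f.1 j : ℕ) = (j : ℕ) - 1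
  high : ∀ j, p < j → p ≤ f.1 j
  succ : (p : ℕ) ≠ 0 → ∀ j : Fin n, (j : ℕ) = p + 1 → f.1 j = p

theorem val_apply_zero {n : ℕ} (f : SEF n) {j : Fin n} (hj : (j : ℕ) = 0) : (f.1 j : ℕ) = 0 := by
  have : (f.1 j : ℕ) ≤ j := f.2 j
  omega

theorem fixMap_self {n : ℕ} (f : SEF n) (w : Fin n) : (fixMap f w).1 w = w := by
  simp [fixMap]

theorem fixMap_of_ne {n : ℕ} (f : SEF n) {w j : Fin n} (h : j ≠ w) :
    (fixMap f w).1 j = f.1 j := by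
  simp [fixMap, h]

theorem prevVal_eq {n : ℕ} (f : SEF n) {w p : Fin n} (hp : p ∈ supp f) (hlt : p < w)
    (hgap : ∀ x ∈ supp f, x ≤ p ∨ w ≤ x) : prevVal f w = p := by
  have hmem : p ∈ (supp f).filter fun x => x < w := by simp [hp, hlt]
  rw [prevVal, dif_pos ⟨p, hmem⟩]
  refine le_antisymm (Finset.max'_le _ _ _ fun x hx => ?_) (Finset.le_max' _ _ hmem)
  rw [Finset.mem_filter] at hx
  exact (hgap x hx.1).resolve_right (not_le.2 hx.2)

theorem nextVal_eq {n : ℕ} (f : SEF n) {w p : Fin n} (hw : w ∈ supp f) (hlt : p < w)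
    (hgap : ∀ x ∈ supp f, x ≤ p ∨ w ≤ x) : nextVal f p = w := by
  have hmem : w ∈ (supp f).filter fun x => p < x := by simp [hw, hlt]
  rw [nextVal, dif_pos ⟨w, hmem⟩]
  refine le_antisymm (Finset.min'_le _ _ hmem) (Finset.le_min' _ _ _ fun x hx => ?_)
  rw [Finset.mem_filter] at hx
  exact (hgap x hx.1).resolve_left (not_le.2 hx.2)

/-- Cases three and four together amount to (E_i), since `f` never exceeds the identity. -/
theorem mem_active {n : ℕ} (f : SEF n) (m : Fin n) :
    m ∈ active f ↔ m ∈ supp f ∧ (m : ℕ) ≠ 0 ∧ (CaseOne f m ∨ CaseTwo f m ∨ CondE f m) := by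
  rw [active, Finset.mem_filter]
  refine and_congr_right fun _ => and_congr_right fun _ => or_congr_right <| or_congr_right ?_
  constructor
  · rintro (h | h) <;> exact h.1
  · intro h
    rcases (f.2 (nextVal f m)).eq_or_lt with h1 | h1
    · exact Or.inl ⟨h, h1⟩
    · exact Or.inr ⟨h, h1⟩

theorem mem_fiberOne {n : ℕ} (f : SEF n) (j : Fin n) : j ∈ fiberOne f ↔ (f.1 j : ℕ) = 0 := by
  simp [fiberOne]

theorem mem_fiber {n : ℕ} (f : SEF n) (j m : Fin n) : j ∈ fiber f m ↔ f.1 j = m := by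
  simp [fiber]

theorem condE_iff {n : ℕ} (f : SEF n) (m : Fin n) : CondE f m ↔
    f.1 m < m ∧ (∃ j, m < f.1 j) ∧ (∀ j, (f.1 j : ℕ) = 0 ↔ (j : ℕ) < 2) ∧
      ∃ j i : Fin n, (j : ℕ) = (m : ℕ) + 1 ∧ f.1 j = m ∧ i ≠ j ∧ f.1 i = m := by
  have h1 : (∃ x ∈ supp f, m < x) ↔ ∃ j, m < f.1 j := by simp [supp]
  have h2 : fiberOne f = (Finset.univ.filter fun j : Fin n => (j : ℕ) < 2) ↔
      ∀ j, (f.1 j : ℕ) = 0 ↔ (j : ℕ) < 2 := by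
    rw [Finset.ext_iff]; simp [mem_fiberOne]
  have h3 : ∀ j : Fin n, {j} ⊂ fiber f m ↔ ∃ i, f.1 j = m ∧ i ≠ j ∧ f.1 i = m := by
    intro j
    rw [Finset.ssubset_iff_exists_cons_subset]
    constructor
    · rintro ⟨i, hi, h⟩
      refine ⟨i, (mem_fiber f j m).1 (h (by simp)), by simpa using hi,
        (mem_fiber f i m).1 (h (by simp))⟩
    · rintro ⟨i, hj, hi, h⟩
      refine ⟨i, by simpa using hi, fun x hx => ?_⟩
      rw [Finset.mem_cons, Finset.mem_singleton] at hx
      rcases hx with rfl | rfl <;> simpa [mem_fiber]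
  rw [CondE, h1, h2]
  simp only [h3, exists_and_left]

theorem two_lt_card_fiberOne {n : ℕ} (f : SEF n) {a b c : Fin n} (hab : a ≠ b) (hac : a ≠ c)
    (hbc : b ≠ c) (ha : (f.1 a : ℕ) = 0) (hb : (f.1 b : ℕ) = 0) (hc : (f.1 c : ℕ) = 0) :
    3 ≤ (fiberOne f).card :=
  Finset.two_lt_card.2 ⟨a, (mem_fiberOne f a).2 ha, b, (mem_fiberOne f b).2 hb, c,
    (mem_fiberOne f c).2 hc, hab, hac, hbc⟩

theorem card_fiberOne_le {n : ℕ} (f : SEF n) (h : ∀ j : Fin n, (f.1 j : ℕ) = 0 → (j : ℕ) < 2) :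
    (fiberOne f).card ≤ 2 := by
  have hm : ∀ j ∈ fiberOne f, (j : ℕ) ∈ Finset.range 2 := fun j hj => by
    simpa using h j ((mem_fiberOne f j).1 hj)
  simpa using Finset.card_le_card_of_injOn _ hm Fin.val_injective.injOn

/-- To the matchless functions no case applies. -/
theorem IsMatchless.active_eq_empty {n : ℕ} {f : SEF n} (hf : IsMatchless f) : active f = ∅ := by
  obtain ⟨k, hk, hf⟩ := hf
  rw [Finset.mem_Icc] at hk
  rw [Finset.eq_empty_iff_forall_notMem]
  intro m hm
  rw [mem_active, mem_supp] at hm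
  obtain ⟨⟨i, hi⟩, hm0, h⟩ := hm
  have hmm := hf m
  have hii := hf i
  rw [hi] at hii
  rw [if_neg hm0] at hmm
  rcases h with h | ⟨-, h⟩ | h
  · rw [CaseOne] at h
    rw [h] at hmm
    omega
  · have : (fiberOne f).card ≤ 2 := card_fiberOne_le f fun j hj => by
      have := hf j
      split_ifs at this hii <;> omega
    omega
  · obtain ⟨-, ⟨a, ha⟩, -, j, b, hj, hfj, hbj, hfb⟩ := (condE_iff f m).1 h
    have h1 := hf a
    have h2 := hf j
    have h3 := hf b
    rw [hfj] at h2
    rw [hfb] at h3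
    have hbj' : (b : ℕ) ≠ j := fun h => hbj (Fin.ext h)
    have ha' : (m : ℕ) < f.1 a := ha
    split_ifs at h1 h2 h3 <;> omega

/-- The value of `Ψ` in terms of the smallest element to which a case applies. -/
theorem Psi_eq {n : ℕ} {f : SEF n} {m : Fin n} (hm : m ∈ active f) (hmin : ∀ x ∈ active f, m ≤ x) :
    Psi f = if CaseOne f m then unfixMap f m
      else if CaseTwo f m then fixMap f m
      else if CaseThree f m then unfixMap f (nextVal f m)
      else fixMap f (nextVal f m) := by
  have hnm : ¬ IsMatchless f := fun h => by simp [h.active_eq_empty] at hm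
  have h : (active f).Nonempty := ⟨m, hm⟩
  have hmm : (active f).min' h = m :=
    le_antisymm (Finset.min'_le _ _ hm) (hmin _ (Finset.min'_mem _ h))
  rw [Psi, if_neg hnm, dif_pos h]
  simp only [hmm]

/-! ### Invariants of a pair and the action of `Ψ` on it -/

namespace Toggle

variable {n : ℕ} {f : SEF n} {w p : Fin n}

theorem supp_fixMap (h : Toggle f w p) : supp (fixMap f w) = supp f := by
  obtain ⟨i, -, hi, hip⟩ := h.other
  obtain ⟨j, hj⟩ := h.mem
  ext v
  rw [mem_supp, mem_supp]
  constructor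
  · rintro ⟨a, ha⟩
    by_cases haw : a = w
    · subst haw; rw [fixMap_self] at ha; exact ⟨j, hj.trans ha⟩
    · rw [fixMap_of_ne f haw] at ha; exact ⟨a, ha⟩
  · rintro ⟨a, ha⟩
    by_cases haw : a = w
    · subst haw; exact ⟨i, by rw [fixMap_of_ne f hi, hip, ← ha, h.val]⟩
    · exact ⟨a, by rw [fixMap_of_ne f haw, ha]⟩

theorem gap_supp (h : Toggle f w p) : ∀ x ∈ supp f, x ≤ p ∨ w ≤ x := by
  intro x hx
  obtain ⟨j, rfl⟩ := (mem_supp f x).1 hx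
  exact h.gap j

theorem lower_mem (h : Toggle f w p) : p ∈ supp f := (mem_supp f p).2 ⟨w, h.val⟩

theorem upper_mem (h : Toggle f w p) : w ∈ supp f := (mem_supp f w).2 h.mem

theorem exists_gt (h : Toggle f w p) : ∃ j, w < j ∧ f.1 j = w := by
  obtain ⟨j, hj⟩ := h.mem
  refine ⟨j, lt_of_le_of_ne (hj ▸ f.2 j) ?_, hj⟩
  rintro rfl
  exact h.lt.ne (h.val.symm.trans hj)

theorem unfixMap_fixMap (h : Toggle f w p) : unfixMap (fixMap f w) w = f := by
  have hp : prevVal (fixMap f w) w = p :=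
    prevVal_eq _ (by rw [h.supp_fixMap]; exact h.lower_mem) h.lt
      (by rw [h.supp_fixMap]; exact h.gap_supp)
  refine Subtype.ext ?_
  show Function.update (Function.update f.1 w w) w (prevVal (fixMap f w) w) = f.1
  rw [hp, Function.update_idem, ← h.val, Function.update_eq_self]

theorem aexc_fixMap (h : Toggle f w p) : aexc (fixMap f w) + 1 = aexc f := by
  have : (Finset.univ.filter fun i => (fixMap f w).1 i < i) =
      (Finset.univ.filter fun i => f.1 i < i).erase w := by
    ext i
    by_cases hi : i = w
    · subst hi; simp [fixMap_self]
    · simp [fixMap_of_ne f hi, hi]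
  rw [aexc, this]
  exact Finset.card_erase_add_one (by simp [h.val, h.lt])

/-- The only preimage lost is `w` over `p`, and `other` supplies a replacement beyond `p`. The new
fixed point `w` has a preimage beyond `w`. -/
theorem mem_DF_fixMap (h : Toggle f w p) : fixMap f w ∈ DF n ↔ f ∈ DF n := by
  obtain ⟨i, hpi, hi, hip⟩ := h.other
  obtain ⟨j, hwj, hj⟩ := h.exists_gt
  rw [mem_DF_iff, mem_DF_iff]
  constructor
  · intro hf x hx
    have hxw : x ≠ w := by
      rintro rfl
      exact h.lt.ne (h.val.symm.trans hx)
    obtain ⟨b, hb, hbx⟩ := hf x (by rw [fixMap_of_ne f hxw, hx])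
    by_cases hbw : b = w
    · subst hbw; rw [fixMap_self] at hbx; exact absurd hbx.symm hxw
    · exact ⟨b, hb, by rw [← hbx, fixMap_of_ne f hbw]⟩
  · intro hf x hx
    by_cases hxw : x = w
    · subst hxw; exact ⟨j, hwj, by rw [fixMap_of_ne f hwj.ne', hj]⟩
    · rw [fixMap_of_ne f hxw] at hx
      obtain ⟨b, hb, hbx⟩ := hf x hx
      by_cases hbw : b = w
      · subst hbw
        have hxp : x = p := by rw [← hbx, h.val]
        subst hxp
        exact ⟨i, hpi, by rw [fixMap_of_ne f hi, hip]⟩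
      · exact ⟨b, hb, by rw [fixMap_of_ne f hbw, hbx]⟩

/-- The value `p` is a right-to-left minimum on both sides, at its last position, because `high`
excludes smaller values beyond `p`. For other values the position `w` is never the witness: its
value is `p` in `f`, and the value `w` recurs later in `fixMap f w`. As a competitor, `w` imposes `v
< p` or `v < w`, which agree for `v ≠ p` in the image by `gap`. -/
theorem RLMv_fixMap (h : Toggle f w p) : RLMv (fixMap f w).1 = RLMv f.1 := by
  obtain ⟨i, hpi, hi, hip⟩ := h.other
  obtain ⟨j, hwj, hj⟩ := h.exists_gt
  have key : ∀ g : SEF n, (∀ b, p < b → p ≤ g.1 b) → g.1 i = p → p ∈ RLMv g.1 := by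
    intro g hg hgi
    obtain ⟨k, hik, hk, -, hl⟩ := exists_last g i
    rw [mem_RLMv]
    refine ⟨k, hk.trans hgi, fun b hb => lt_of_le_of_ne (hg b ?_) ?_⟩
    · exact hpi.trans_le (hik.trans hb.le)
    · rw [← hgi]; exact (hl b hb).symm
  ext v
  by_cases hvp : v = p
  · subst hvp
    refine iff_of_true (key _ (fun b hb => ?_) (by rw [fixMap_of_ne f hi, hip]))
      (key _ h.high hip)
    by_cases hbw : b = w
    · subst hbw; rw [fixMap_self]; exact hb.le
    · rw [fixMap_of_ne f hbw]; exact h.high b hb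
  rw [mem_RLMv, mem_RLMv]
  constructor
  · rintro ⟨a, ha, hl⟩
    have haw : a ≠ w := by
      rintro rfl
      rw [fixMap_self] at ha
      have := hl j hwj
      rw [fixMap_of_ne f hwj.ne', hj, ha] at this
      exact lt_irrefl _ this
    rw [fixMap_of_ne f haw] at ha
    refine ⟨a, ha, fun b hb => ?_⟩
    by_cases hbw : b = w
    · subst hbw
      have h1 := hl b hb
      rw [fixMap_self] at h1
      rw [h.val]
      refine lt_of_le_of_ne ?_ hvp
      rcases h.gap a with h2 | h2
      · rwa [ha] at h2
      · rw [ha] at h2; exact absurd h1 (not_lt.2 h2)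
    · have := hl b hb
      rwa [fixMap_of_ne f hbw] at this
  · rintro ⟨a, ha, hl⟩
    have haw : a ≠ w := by
      rintro rfl
      exact hvp (ha.symm.trans h.val)
    refine ⟨a, by rw [fixMap_of_ne f haw, ha], fun b hb => ?_⟩
    by_cases hbw : b = w
    · subst hbw
      have := hl b hb
      rw [h.val] at this
      rw [fixMap_self]; exact this.trans h.lt
    · rw [fixMap_of_ne f hbw]; exact hl b hb

/-- No case applies to `x < p`, neither for `f` nor for `fixMap f w`. -/
theorem le_of_mem_active (h : Toggle f w p) {g : SEF n} (hg : ∀ j, j ≠ w → g.1 j = f.1 j)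
    (hgw : p ≤ g.1 w) {x : Fin n} (hx : x ∈ active g) : p ≤ x := by
  by_contra hc
  have hlt : (x : ℕ) < p := not_le.1 hc
  have hpw : (p : ℕ) < w := h.lt
  have hgw' : (p : ℕ) ≤ g.1 w := hgw
  have low : ∀ j : Fin n, (j : ℕ) ≤ p → (g.1 j : ℕ) = (j : ℕ) - 1 := fun j hj => by
    rw [hg j (by rintro rfl; omega)]; exact h.low j hj
  have high : ∀ j : Fin n, (p : ℕ) < j → (p : ℕ) ≤ g.1 j := fun j hj => by
    by_cases hjw : j = w
    · rw [hjw]; exact hgw'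
    · rw [hg j hjw]; exact h.high j hj
  rw [mem_active] at hx
  obtain ⟨-, hx0, h1 | ⟨-, h1⟩ | h1⟩ := hx
  · have := low x hlt.le
    rw [CaseOne] at h1
    rw [h1] at this
    omega
  · have : (fiberOne g).card ≤ 2 := card_fiberOne_le g fun j hj => by
      by_contra hc
      rcases le_or_gt (j : ℕ) p with h2 | h2
      · have := low j h2; omega
      · have := high j h2; omega
    omega
  -- For `0 < x < p` the fibre over `x` is just `{x + 1}`, so the strict inclusion in (E_i) fails.
  · obtain ⟨-, -, -, j, b, hj, hfj, hbj, hfb⟩ := (condE_iff g x).1 h1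
    have hbj' : (b : ℕ) ≠ j := fun h => hbj (Fin.ext h)
    rcases le_or_gt (b : ℕ) p with h2 | h2
    · have := low b h2
      rw [hfb] at this
      omega
    · have := high b h2
      rw [hfb] at this
      omega

/-- Between `p` and `w` there is nothing to which a case could apply. -/
theorem eq_or_le_of_mem_active (h : Toggle f w p) {g : SEF n} (hs : supp g = supp f)
    (hg : ∀ j, j ≠ w → g.1 j = f.1 j) (hgw : p ≤ g.1 w) {x : Fin n} (hx : x ∈ active g) :
    x = p ∨ w ≤ x := by
  have h1 := h.le_of_mem_active hg hgw hx
  rcases h.gap_supp x (hs ▸ ((mem_active g x).1 hx).1) with h2 | h2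
  · exact Or.inl (le_antisymm h2 h1)
  · exact Or.inr h2

theorem Psi_eq_fixMap (h : Toggle f w p) : Psi f = fixMap f w := by
  obtain ⟨i, hpi, hi, hip⟩ := h.other
  have hpw : (p : ℕ) < w := h.lt
  have hmin := fun x (hx : x ∈ active f) =>
    h.eq_or_le_of_mem_active rfl (fun _ _ => rfl) h.val.ge hx
  by_cases hp0 : (p : ℕ) = 0
  -- The positions `0`, `i` and `w` are three preimages of `0`, so case two applies at `w`.
  · have hpi' : (p : ℕ) < i := hpi
    have hcard : 3 ≤ (fiberOne f).card :=
      two_lt_card_fiberOne f hpi.ne h.lt.ne hi (val_apply_zero f hp0) (by rw [hip, hp0])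
        (by rw [h.val, hp0])
    have h2 : CaseTwo f w := ⟨by rw [h.val]; exact h.lt, hcard⟩
    have hm : w ∈ active f := (mem_active f w).2 ⟨h.upper_mem, by omega, Or.inr (Or.inl h2)⟩
    rw [Psi_eq hm fun x hx => ?_, if_neg (by rw [CaseOne, h.val]; exact h.lt.ne), if_pos h2]
    rcases hmin x hx with rfl | h3
    · exact absurd hp0 ((mem_active f x).1 hx).2.1
    · exact h3
  -- For `p ≠ 0` condition (E_i) holds at `p`. The next image element is `w` and `f w < w`, so case
  -- four applies.
  · have hfp := h.low p le_rfl
    have hfp' : f.1 p < p := by rw [Fin.lt_def]; omega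
    have hone : ∀ j, (f.1 j : ℕ) = 0 ↔ (j : ℕ) < 2 := by
      intro j
      rcases le_or_gt (j : ℕ) p with h1 | h1
      · have := h.low j h1; omega
      · have : (p : ℕ) ≤ f.1 j := h.high j h1
        omega
    have hw : (w : ℕ) < n := w.2
    -- Besides `p + 1`, the second preimage of `p` is `i`, or `w` if `i = p + 1`.
    obtain ⟨a, b, hab, ha, hb, hfa, hfb⟩ : ∃ a b : Fin n, a ≠ b ∧ (a : ℕ) = p + 1 ∧
        f.1 a = p ∧ f.1 b = p ∧ b ≠ a := by
      refine ⟨⟨p + 1, by omega⟩, ?_⟩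
      have hs := h.succ hp0 ⟨p + 1, by omega⟩ rfl
      by_cases hia : i = ⟨p + 1, by omega⟩
      · exact ⟨w, by rw [← hia]; exact hi, rfl, hs, h.val, by rw [← hia]; exact hi.symm⟩
      · exact ⟨i, Ne.symm hia, rfl, hs, hip, hia⟩
    obtain ⟨j, hj⟩ := h.mem
    have hE : CondE f p := (condE_iff f p).2
      ⟨hfp', ⟨j, by rw [hj]; exact h.lt⟩, hone, a, b, ha, hb, hfb, hfa⟩
    have hcard := card_fiberOne_le f fun j hj => (hone j).1 hj
    have hnext := nextVal_eq f h.upper_mem h.lt h.gap_supp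
    have hm : p ∈ active f := (mem_active f p).2 ⟨h.lower_mem, hp0, Or.inr (Or.inr hE)⟩
    rw [Psi_eq hm fun x hx => ?_, if_neg hfp'.ne, if_neg (fun h2 => by have := h2.2; omega),
      if_neg, hnext]
    · rintro ⟨-, h3⟩
      rw [hnext, h.val] at h3
      exact h.lt.ne h3
    · rcases hmin x hx with rfl | h3
      · exact le_rfl
      · exact h.lt.le.trans h3

theorem Psi_fixMap (h : Toggle f w p) : Psi (fixMap f w) = f := by
  have hpw : (p : ℕ) < w := h.lt
  have hs := h.supp_fixMap
  have hmin := fun x (hx : x ∈ active (fixMap f w)) =>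
    h.eq_or_le_of_mem_active hs (fun _ hj => fixMap_of_ne f hj)
      (by rw [fixMap_self]; exact h.lt.le) hx
  have hnext : nextVal (fixMap f w) p = w :=
    nextVal_eq _ (by rw [hs]; exact h.upper_mem) h.lt (by rw [hs]; exact h.gap_supp)
  -- Having lost the preimage `w`, `p` may or may not still satisfy (E_i). If it does, case three at
  -- `p` unfixes `w`; if not, case one at `w` does the same.
  by_cases hpm : p ∈ active (fixMap f w)
  · have hp := (mem_active _ _).1 hpm
    have hp0 := hp.2.1
    have hgp : ((fixMap f w).1 p : ℕ) = p - 1 := by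
      rw [fixMap_of_ne f h.lt.ne]; exact h.low p le_rfl
    have h1 : ¬ CaseOne (fixMap f w) p := fun h1 => by
      rw [CaseOne] at h1
      rw [h1] at hgp
      omega
    have h2 : ¬ CaseTwo (fixMap f w) p := fun h2 => by
      have : (fiberOne (fixMap f w)).card ≤ 2 := card_fiberOne_le _ fun j hj => by
        by_cases hjw : j = w
        · subst hjw; rw [fixMap_self] at hj; omega
        · rw [fixMap_of_ne f hjw] at hj
          rcases le_or_gt (j : ℕ) p with h3 | h3
          · have := h.low j h3; omega
          · have : (p : ℕ) ≤ f.1 j := h.high j h3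
            omega
      have := h2.2
      omega
    have h3 : CaseThree (fixMap f w) p :=
      ⟨(hp.2.2.resolve_left h1).resolve_left h2, by rw [hnext, fixMap_self]⟩
    rw [Psi_eq hpm fun x hx => ?_, if_neg h1, if_neg h2, if_pos h3, hnext, h.unfixMap_fixMap]
    rcases hmin x hx with rfl | h3
    · exact le_rfl
    · exact h.lt.le.trans h3
  · have hm : w ∈ active (fixMap f w) := (mem_active _ _).2
      ⟨by rw [hs]; exact h.upper_mem, by omega, Or.inl (fixMap_self f w)⟩
    rw [Psi_eq hm fun x hx => ?_, if_pos (fixMap_self f w), h.unfixMap_fixMap]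
    exact (hmin x hx).resolve_left fun h4 => hpm (h4 ▸ hx)

end Toggle


/-! ### The orbits of `Ψ` -/

/-- The hypotheses fit both members of a pair. If `f w = w`, the other member is recovered by
resetting this value to `p`, and `f ∈ DF n` ensures that `w` stays in the image. Position `w` is
exempt in `succ` because the member with value `p` there satisfies it. -/
theorem toggle_or_eq_fixMap {n : ℕ} {f : SEF n} (hf : f ∈ DF n) {w p : Fin n} (lt : p < w)
    (val : f.1 w = p ∨ f.1 w = w) (gap : ∀ j, f.1 j ≤ p ∨ w ≤ f.1 j) (mem : ∃ j, f.1 j = w)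
    (other : ∃ i, p < i ∧ i ≠ w ∧ f.1 i = p) (low : ∀ j, j ≤ p → (f.1 j : ℕ) = (j : ℕ) - 1)
    (high : ∀ j, p < j → p ≤ f.1 j)
    (succ : (p : ℕ) ≠ 0 → ∀ j : Fin n, j ≠ w → (j : ℕ) = p + 1 → f.1 j = p) :
    ∃ g w p, Toggle g w p ∧ (f = g ∨ f = fixMap g w) := by
  rcases val with val | val
  · refine ⟨f, w, p, ⟨lt, val, gap, mem, other, low, high, fun hp j hj => ?_⟩, Or.inl rfl⟩
    by_cases hjw : j = w
    · rw [hjw, val]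
    · exact succ hp j hjw hj
  · obtain ⟨b, hb, hbw⟩ := (mem_DF_iff f).1 hf w val
    obtain ⟨i, hpi, hi, hip⟩ := other
    let g : SEF n := ⟨Function.update f.1 w p, update_le f lt.le⟩
    have hgw : g.1 w = p := by simp [g]
    have hg : ∀ j, j ≠ w → g.1 j = f.1 j := fun j hj => by simp [g, hj]
    refine ⟨g, w, p, ⟨lt, hgw, fun j => ?_, ⟨b, by rw [hg b hb.ne', hbw]⟩,
      ⟨i, hpi, hi, by rw [hg i hi, hip]⟩, fun j hj => ?_, fun j hj => ?_, fun hp j hj => ?_⟩,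
      Or.inr ?_⟩
    · by_cases hjw : j = w
      · rw [hjw, hgw]; exact Or.inl le_rfl
      · rw [hg j hjw]; exact gap j
    · rw [hg j (hj.trans_lt lt).ne]; exact low j hj
    · by_cases hjw : j = w
      · rw [hjw, hgw]
      · rw [hg j hjw]; exact high j hj
    · by_cases hjw : j = w
      · rw [hjw, hgw]
      · rw [hg j hjw]; exact succ hp j hjw hj
    · refine Subtype.ext (funext fun j => ?_)
      by_cases hjw : j = w
      · rw [hjw, fixMap_self, val]
      · rw [fixMap_of_ne g hjw, hg j hjw]

/-- The next element of the image above `t`, if there is one. -/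
theorem exists_next {n : ℕ} (f : SEF n) {t : Fin n} (h : ∃ j, t < f.1 j) :
    ∃ w, t < w ∧ (∃ j, f.1 j = w) ∧ ∀ j, f.1 j ≤ t ∨ w ≤ f.1 j := by
  obtain ⟨j, hj⟩ := h
  have hne : ((supp f).filter fun x => t < x).Nonempty :=
    ⟨f.1 j, Finset.mem_filter.2 ⟨(mem_supp f _).2 ⟨j, rfl⟩, hj⟩⟩
  have hw := Finset.mem_filter.1 (Finset.min'_mem _ hne)
  refine ⟨_, hw.2, (mem_supp f _).1 hw.1, fun i => ?_⟩
  by_cases hi : f.1 i ≤ t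
  · exact Or.inl hi
  · exact Or.inr (Finset.min'_le _ _
      (Finset.mem_filter.2 ⟨(mem_supp f _).2 ⟨i, rfl⟩, not_le.1 hi⟩))

/-- The case of a function that starts like a matchless one. -/
theorem exists_toggle_of_prefix {n : ℕ} {f : SEF n} (hf : f ∈ DF n) (hm : ¬ IsMatchless f)
    (d : ℕ) : ∀ t : Fin n, n = t + 1 + d → (t : ℕ) ≠ 0 →
      (∀ j, j ≤ t → (f.1 j : ℕ) = (j : ℕ) - 1) → (∀ j, t < j → t ≤ f.1 j) →
      ∃ g w p, Toggle g w p ∧ (f = g ∨ f = fixMap g w) := by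
  induction d with
  | zero =>
    intro t ht ht0 low _
    -- The prefix is the whole word, so `k = n - 1 = t`.
    refine absurd ⟨t, Finset.mem_Icc.2 ⟨by omega, by omega⟩, fun j => ?_⟩ hm
    have := low j (by rw [Fin.le_def]; omega)
    split_ifs <;> omega
  | succ d ih =>
    intro t ht ht0 low high
    let s : Fin n := ⟨t + 1, by omega⟩
    have hs : (s : ℕ) = t + 1 := rfl
    have hts : t < s := by rw [Fin.lt_def]; omega
    have hft := low t le_rfl
    have hfs : (t : ℕ) ≤ f.1 s := high s hts
    have hfs' : (f.1 s : ℕ) ≤ s := f.2 s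
    -- Only two values are possible at `s = t + 1`; `f s = s` breaks the pattern at once.
    rcases (show (f.1 s : ℕ) = s ∨ (f.1 s : ℕ) = t by omega) with h1 | h1
    · have h1 := Fin.ext h1
      by_cases hex : ∃ i, f.1 i = t
      · obtain ⟨i, hi⟩ := hex
        have hti : t < i := by
          refine lt_of_le_of_ne (hi ▸ f.2 i) ?_
          rintro rfl
          rw [hi] at hft
          omega
        have his : i ≠ s := by
          rintro rfl
          exact hts.ne (hi.symm.trans h1)
        refine toggle_or_eq_fixMap hf hts (Or.inr h1) (fun j => ?_) ⟨s, h1⟩ ⟨i, hti, his, hi⟩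
          low high (fun _ j hj hj' => absurd (Fin.ext hj') hj)
        simp only [Fin.le_def]
        omega
      -- If `t` is not a value, the element preceding `s` in the image is `t - 1`, and position `t`
      -- is its further preimage.
      · let p : Fin n := ⟨t - 1, by omega⟩
        have hp : (p : ℕ) = t - 1 := rfl
        have hpt : p < t := by rw [Fin.lt_def]; omega
        have hftp : f.1 t = p := Fin.ext hft
        refine toggle_or_eq_fixMap hf (hpt.trans hts) (Or.inr h1) (fun j => ?_) ⟨s, h1⟩
          ⟨t, hpt, hts.ne, hftp⟩ (fun j hj => low j (hj.trans hpt.le)) (fun j hj => ?_)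
          (fun _ j _ hj => ?_)
        · have : (f.1 j : ℕ) ≠ t := fun h => hex ⟨j, Fin.ext h⟩
          simp only [Fin.le_def]
          omega
        · rw [Fin.lt_def] at hj
          rcases (show (j : ℕ) = t ∨ (t : ℕ) < j by omega) with h2 | h2
          · rw [Fin.ext h2, hftp]
          · exact hpt.le.trans (high j h2)
        · rw [show j = t from Fin.ext (by omega), hftp]
    · have h1 := Fin.ext h1
      by_cases hex : ∃ i, i ≠ s ∧ f.1 i = t
      · obtain ⟨i, his, hi⟩ := hex
        have hti : t < i := by
          refine lt_of_le_of_ne (hi ▸ f.2 i) ?_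
          rintro rfl
          rw [hi] at hft
          omega
        by_cases hmax : ∃ j, t < f.1 j
        · obtain ⟨w, htw, hw, gap⟩ := exists_next f hmax
          refine toggle_or_eq_fixMap hf htw ?_ gap hw ?_ low high ?_
          · rcases gap w with h2 | h2
            · exact Or.inl (le_antisymm h2 (high w htw))
            · exact Or.inr (le_antisymm (f.2 w) h2)
          · by_cases hsw : s = w
            · exact ⟨i, hti, hsw ▸ his, hi⟩
            · exact ⟨s, hts, hsw, h1⟩
          · intro _ j _ hj
            rw [show j = s from Fin.ext hj, h1]
        -- From `s` on, `f` is constantly `t`, which stands for the number `k = t + 1`.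
        · refine absurd ⟨t + 1, Finset.mem_Icc.2 ⟨by omega, by omega⟩, fun j => ?_⟩ hm
          rcases le_or_gt j t with h2 | h2
          · have := low j h2
            rw [Fin.le_def] at h2
            split_ifs <;> omega
          · have h3 : (t : ℕ) ≤ f.1 j := high j h2
            have h4 : ¬ (t : ℕ) < f.1 j := fun h => hmax ⟨j, h⟩
            rw [Fin.lt_def] at h2
            split_ifs <;> omega
      -- The value `t` occurs only at `s`, so the prefix extends to `s` and later values are at
      -- least `s`.
      · refine ih s (by omega) (by omega) (fun j hj => ?_) (fun j hj => ?_)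
        · rw [Fin.le_def] at hj
          rcases (show (j : ℕ) = s ∨ (j : ℕ) ≤ t by omega) with h2 | h2
          · rw [Fin.ext h2, h1, hs]; omega
          · exact low j h2
        · have h3 : (t : ℕ) ≤ f.1 j := high j (hts.trans hj)
          have h4 : (f.1 j : ℕ) ≠ t := fun h => hex ⟨j, hj.ne', Fin.ext h⟩
          rw [Fin.le_def]
          omega

/-- A function in `DF n` that is not matchless belongs to one of the pairs exchanged by `Ψ`. -/
theorem exists_toggle {n : ℕ} (hn : 1 ≤ n) {f : SEF n} (hf : f ∈ DF n) (hm : ¬ IsMatchless f) :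
    ∃ g w p, Toggle g w p ∧ (f = g ∨ f = fixMap g w) := by
  let z : Fin n := ⟨0, hn⟩
  have hz : (z : ℕ) = 0 := rfl
  have hfz : f.1 z = z := Fin.ext (val_apply_zero f hz)
  obtain ⟨a, hza, ha⟩ := (mem_DF_iff f).1 hf z hfz
  have hza' : (z : ℕ) < a := hza
  have low : ∀ j, j ≤ z → (f.1 j : ℕ) = (j : ℕ) - 1 := fun j hj => by
    have h1 : (j : ℕ) ≤ z := hj
    have := val_apply_zero f (j := j) (by omega)
    omega
  have high : ∀ j, z ≤ f.1 j := fun j => by rw [Fin.le_def]; omega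
  by_cases hmax : ∃ j, z < f.1 j
  · obtain ⟨w, hzw, hw, gap⟩ := exists_next f hmax
    by_cases hother : ∃ i, z < i ∧ i ≠ w ∧ f.1 i = z
    · refine toggle_or_eq_fixMap hf hzw ?_ gap hw hother low (fun j _ => high j)
        (fun h => absurd hz h)
      rcases gap w with h2 | h2
      · exact Or.inl (le_antisymm h2 (high w))
      · exact Or.inr (le_antisymm (f.2 w) h2)
    -- Here `w` is the only preimage of `0` other than `0`. A nonzero value at position `1` would be
    -- at least `w`, so `w = 1` in any case and `f` starts `0, 0`.
    · push Not at hother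
      have haw : a = w := by
        by_contra h
        exact hother a hza h ha
      have han : (a : ℕ) < n := a.2
      let o : Fin n := ⟨1, by omega⟩
      have ho : (o : ℕ) = 1 := rfl
      have hfo : (f.1 o : ℕ) ≤ o := f.2 o
      have hao : a = o := by
        by_contra h
        have h1 : f.1 o ≠ z := hother o (by rw [Fin.lt_def]; omega) (fun h' => h (haw.trans h'.symm))
        have h2 : (f.1 o : ℕ) ≠ z := fun h' => h1 (Fin.ext h')
        rcases gap o with h3 | h3
        · rw [Fin.le_def] at h3; omega
        · rw [Fin.le_def, ← haw] at h3
          have : (a : ℕ) ≠ o := fun h' => h (Fin.ext h')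
          omega
      rw [hao] at ha haw
      refine exists_toggle_of_prefix hf hm (n - 2) o (by omega) (by omega) (fun j hj => ?_)
        (fun j hj => ?_)
      · rw [Fin.le_def] at hj
        rcases (show (j : ℕ) = 0 ∨ (j : ℕ) = o by omega) with h2 | h2
        · have := val_apply_zero f h2; omega
        · rw [Fin.ext h2, ha, hz, ho]
      · rw [Fin.lt_def] at hj
        have h1 := hother j (by rw [Fin.lt_def]; omega) (fun h => by rw [h, ← haw] at hj; omega)
        have h2 : (f.1 j : ℕ) ≠ z := fun h' => h1 (Fin.ext h')
        rw [Fin.le_def]; omega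
  -- No positive value occurs, so `f` is the constant word with `k = 1`.
  · refine absurd ⟨1, Finset.mem_Icc.2 ⟨le_rfl, by omega⟩, fun j => ?_⟩ hm
    have h4 : ¬ (z : ℕ) < f.1 j := fun h => hmax ⟨j, h⟩
    split_ifs <;> omega

/-! ### Matchless functions -/

theorem IsMatchless.mem_DF {n : ℕ} {f : SEF n} (hf : IsMatchless f) : f ∈ DF n := by
  obtain ⟨k, hk, hf⟩ := hf
  rw [Finset.mem_Icc] at hk
  rw [mem_DF_iff]
  intro i hi
  have hii := hf i
  rw [hi] at hii
  split_ifs at hii with h0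
  -- The only fixed point is `0`, and its value recurs at position `1`, which exists since `1 ≤ k ≤
  -- n - 1`.
  · refine ⟨⟨1, by omega⟩, by rw [Fin.lt_def, h0]; exact Nat.zero_lt_one, Fin.ext ?_⟩
    have := hf ⟨1, by omega⟩
    rw [if_neg (by simp)] at this
    simp only at this
    omega
  · omega

theorem Psi_of_isMatchless {n : ℕ} {f : SEF n} (hf : IsMatchless f) : Psi f = f := by
  rw [Psi, if_pos hf]

/-- The matchless function `1 1 2 3 ⋯ (k-1) k k ⋯ k`. -/
def matchless (n k : ℕ) : SEF n :=
  ⟨fun j => ⟨min (j : ℕ) k - 1, by omega⟩, fun j => by rw [Fin.le_def]; simp only; omega⟩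

theorem isMatchless_iff {n : ℕ} (f : SEF n) :
    IsMatchless f ↔ ∃ k ∈ Finset.Icc 1 (n - 1), matchless n k = f := by
  refine exists_congr fun k => and_congr_right fun hk => ?_
  rw [Finset.mem_Icc] at hk
  constructor
  · intro h
    refine Subtype.ext (funext fun j => Fin.ext ?_)
    have := h j
    simp only [matchless]
    split_ifs at this <;> omega
  · rintro rfl j
    simp only [matchless]
    split_ifs <;> omega

theorem ncard_isMatchless (n : ℕ) : {f : SEF n | IsMatchless f}.ncard = n - 1 := by
  have h : {f : SEF n | IsMatchless f} = matchless n '' (Finset.Icc 1 (n - 1) : Set ℕ) := by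
    ext f
    simp [isMatchless_iff]
  have hinj : Set.InjOn (matchless n) (Finset.Icc 1 (n - 1) : Set ℕ) := by
    intro k hk l hl hkl
    rw [Finset.mem_coe, Finset.mem_Icc] at hk hl
    -- The last letter determines `k`, because `k ≤ n - 1`.
    have := congrArg (fun f : SEF n => (f.1 ⟨n - 1, by omega⟩ : ℕ)) hkl
    simp only [matchless] at this
    omega
  rw [h, hinj.ncard_image, Set.ncard_coe_finset, Nat.card_Icc, Nat.add_sub_cancel]

/-! ### The properties of `Ψ` -/

theorem Psi_involutive_and_invariants {n : ℕ} (hn : 1 ≤ n) {f : SEF n} (hf : f ∈ DF n) :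
    Psi f ∈ DF n ∧ Psi (Psi f) = f ∧ supp (Psi f) = supp f ∧ RLMv (Psi f).1 = RLMv f.1 ∧
      (¬ IsMatchless f → aexc (Psi f) = aexc f + 1 ∨ aexc (Psi f) + 1 = aexc f) := by
  by_cases hm : IsMatchless f
  · simp [Psi_of_isMatchless hm, hf, hm]
  · obtain ⟨g, w, p, h, rfl | rfl⟩ := exists_toggle hn hf hm
    · rw [h.Psi_eq_fixMap]
      exact ⟨h.mem_DF_fixMap.2 hf, h.Psi_fixMap, h.supp_fixMap, h.RLMv_fixMap,
        fun _ => Or.inr h.aexc_fixMap⟩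
    · rw [h.Psi_fixMap]
      exact ⟨h.mem_DF_fixMap.1 hf, h.Psi_eq_fixMap, h.supp_fixMap.symm, h.RLMv_fixMap.symm,
        fun _ => Or.inl h.aexc_fixMap.symm⟩

theorem Psi_eq_self_iff {n : ℕ} (hn : 1 ≤ n) {f : SEF n} (hf : f ∈ DF n) :
    Psi f = f ↔ IsMatchless f := by
  refine ⟨fun h => ?_, Psi_of_isMatchless⟩
  by_contra hm
  have := (Psi_involutive_and_invariants hn hf).2.2.2.2 hm
  rw [h] at this
  omega

/-! ### Transfer to derangements -/

theorem permToSef_PsiHat {n : ℕ} (σ : Equiv.Perm (Fin n)) :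
    permToSef (PsiHat σ) = Psi (permToSef σ) :=
  permToSef_sefToPerm _

theorem permToSef_mem_DF {n : ℕ} {σ : Equiv.Perm (Fin n)} (hσ : σ ∈ derangements (Fin n)) :
    permToSef σ ∈ DF n :=
  ⟨σ, hσ, rfl⟩

theorem PsiHat_eq_self_iff {n : ℕ} (hn : 1 ≤ n) {σ : Equiv.Perm (Fin n)}
    (hσ : σ ∈ derangements (Fin n)) : PsiHat σ = σ ↔ IsMatchless (permToSef σ) := by
  rw [← Psi_eq_self_iff hn (permToSef_mem_DF hσ), ← permToSef_PsiHat]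
  exact (sefEquivPerm n).symm.injective.eq_iff.symm

/-- Matchless functions lie in `DF n` automatically, so the count carries over along the bijection.
-/
theorem ncard_matchlessDerangements (n : ℕ) : (matchlessDerangements n).ncard = n - 1 := by
  have h : matchlessDerangements n = sefToPerm '' {f : SEF n | IsMatchless f} := by
    ext σ
    constructor
    · exact fun h => ⟨_, h.2, sefToPerm_permToSef σ⟩
    · rintro ⟨f, hf, rfl⟩
      exact ⟨(mem_DF f).1 hf.mem_DF, by rw [permToSef_sefToPerm]; exact hf⟩
  rw [h, Set.ncard_image_of_injective _ (sefToPerm_injective n), ncard_isMatchless]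

theorem EXCv_eq {n : ℕ} (σ : Equiv.Perm (Fin n)) : EXCv σ = (supp (permToSef σ))ᶜ := by
  rw [← EXCv_sefToPerm, sefToPerm_permToSef]

theorem RLMv_eq {n : ℕ} (σ : Equiv.Perm (Fin n)) : RLMv σ = RLMv (permToSef σ).1 := by
  rw [← RLMv_sefToPerm, sefToPerm_permToSef]

theorem sign_eq {n : ℕ} (σ : Equiv.Perm (Fin n)) :
    Equiv.Perm.sign σ = (-1) ^ aexc (permToSef σ) := by
  rw [← sign_sefToPerm, sefToPerm_permToSef]

end Subexcedant

theorem mainTheorem2 (n : ℕ) (hn : 1 ≤ n) :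
    -- `Ψ` is an involution on the subexcedant functions of derangements
    ((∀ f ∈ DF n, Psi f ∈ DF n ∧ Psi (Psi f) = f) ∧
      -- its fixed elements are exactly the matchless subexcedant functions
      {f : SEF n | f ∈ DF n ∧ Psi f = f} = {f : SEF n | IsMatchless f} ∧
      -- it preserves the image and the right-to-left minima values
      (∀ f ∈ DF n, supp (Psi f) = supp f ∧ RLMv (Psi f).1 = RLMv f.1) ∧
      -- it changes the number of strict anti-excedances by one off the matchless functions
      (∀ f ∈ DF n, ¬ IsMatchless f →
        aexc (Psi f) = aexc f + 1 ∨ aexc (Psi f) + 1 = aexc f)) ∧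
    -- `Ψ̂` is an involution on derangements
    ((∀ σ ∈ derangements (Fin n), PsiHat σ ∈ derangements (Fin n) ∧ PsiHat (PsiHat σ) = σ) ∧
      -- its fixed elements are exactly the matchless derangements, of which there are `n - 1`
      {σ : Equiv.Perm (Fin n) | σ ∈ derangements (Fin n) ∧ PsiHat σ = σ} =
        matchlessDerangements n ∧
      (matchlessDerangements n).ncard = n - 1 ∧
      -- it preserves the excedance values and the right-to-left minima values
      (∀ σ ∈ derangements (Fin n),
        EXCv (PsiHat σ) = EXCv σ ∧ RLMv (PsiHat σ) = RLMv σ) ∧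
      -- it reverses the sign of every non-matchless derangement
      (∀ σ ∈ derangements (Fin n), σ ∉ matchlessDerangements n →
        Equiv.Perm.sign (PsiHat σ) = - Equiv.Perm.sign σ)) := by
  have main := fun f (hf : f ∈ DF n) => Psi_involutive_and_invariants hn hf
  have mainHat := fun σ (hσ : σ ∈ derangements (Fin n)) => main _ (permToSef_mem_DF hσ)
  refine ⟨⟨fun f hf => ⟨(main f hf).1, (main f hf).2.1⟩, ?_,
    fun f hf => ⟨(main f hf).2.2.1, (main f hf).2.2.2.1⟩, fun f hf => (main f hf).2.2.2.2⟩,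
    fun σ hσ => ⟨(mem_DF _).1 (mainHat σ hσ).1, ?_⟩, ?_, ncard_matchlessDerangements n,
    fun σ hσ => ⟨?_, ?_⟩, fun σ hσ hm => ?_⟩
  · ext f
    exact ⟨fun h => (Psi_eq_self_iff hn h.1).1 h.2,
      fun h => ⟨h.mem_DF, Psi_of_isMatchless h⟩⟩
  · rw [PsiHat, permToSef_PsiHat, (mainHat σ hσ).2.1, sefToPerm_permToSef]
  · ext σ
    exact and_congr_right fun hσ => PsiHat_eq_self_iff hn hσ
  · rw [EXCv_eq, EXCv_eq, permToSef_PsiHat, (mainHat σ hσ).2.2.1]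
  · rw [RLMv_eq, RLMv_eq, permToSef_PsiHat, (mainHat σ hσ).2.2.2.1]
  · rw [sign_eq, sign_eq, permToSef_PsiHat]
    rcases (mainHat σ hσ).2.2.2.2 fun h => hm ⟨hσ, h⟩ with h | h
    · rw [h, pow_succ, mul_neg_one]
    · rw [← h, pow_succ, mul_neg_one, neg_neg]
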